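/- Let $X_1,\dots,X_m\subset\mathbb{R}^n$ be pairwise disjoint open sets with compact closures. For each $j\in[m]=\{1,\dots,m\}$ let $\phi_j$ be a Borel probability measure that has a density with respect to Lebesgue measure restricted to $X_j$, this density being bounded from below on $X_j$ (almost everywhere) by a constant $c>0$ (so the support of $\phi_j$ is $\overline{X_j}$). For $t\in\mathbb{N}$ let $\mathbf{v}_t(x)=(x^\alpha)_{|\alpha|\le t}$ be the vector of monomials of total degree at most $t$. For a Borel measure $\phi$ on $\mathbb{R}^n$ with finite moments let $\mathbf{M}_t(\phi)=\big(\int x^{\alpha+\beta}\,d\phi\big)_{|\alpha|,|\beta|\le t}$ be its moment matrix and, when $\mathbf{M}_t(\phi)$ is nonsingular, let $$\Lambda^{\phi}_t(x)=\big[\mathbf{v}_t(x)^T\,\mathbf{M}_t(\phi)^{-1}\,\mathbf{v}_t(x)\big]^{-1},\qquad x\in\mathbb{R}^n,$$ be its Christoffel function. For $\varepsilon>0$ let $X_j^\varepsilon=\{x\in X_j : d(x,\partial X_j)>\varepsilon\}$, where the distance to the empty set is $+\infty$. Fix $\varepsilon>0$. Then there is $t_\varepsilon\in\mathbb{N}$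 such that the following holds for every integer $t>t_\varepsilon$. For each $j\in[m]$ let $x^j(1),x^j(2),\dots$ be i.i.d. random vectors with distribution $\phi_j$, all defined on a common probability space, and let $\phi_{j,N}=\frac1N\sum_{i=1}^N\delta_{x^j(i)}$. Then, with probability $1$, for all sufficiently large $N$: the moment matrices $\mathbf{M}_t(\phi_{k,N})$, $k\in[m]$, are nonsingular, and the empirical classifier $\hat f^N_t(x)=\arg\max_{k\in[m]}\Lambda^{\phi_{k,N}}_t(x)$ satisfies $$\hat f^N_t(x)=j\qquad\text{for all } j\in[m] \text{ and all } x\in X_j^\varepsilon,$$ that is, $k=j$ is the unique maximizer of $\Lambda^{\phi_{k,N}}_t(x)$ over $k\in[m]$. -/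

import Mathlib

open MeasureTheory ProbabilityTheory Filter Matrix
open scoped ENNReal

noncomputable section

namespace Christoffel

/-- Multi-indices `α ∈ ℕⁿ` of total degree `|α| = ∑ i, α i` at most `t`
(see `mem_multiIndices` for the characterization). -/
def multiIndices (n t : ℕ) : Finset (Fin n → ℕ) :=
  (Fintype.piFinset fun _ => Finset.range (t + 1)).filter fun α => ∑ i, α i ≤ t

theorem mem_multiIndices {n t : ℕ} {α : Fin n → ℕ} :
    α ∈ multiIndices n t ↔ ∑ i, α i ≤ t := by
  simp only [multiIndices, Finset.mem_filter, Fintype.mem_piFinset, Finset.mem_range,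
    and_iff_right_iff_imp]
  intro h i
  have := Finset.single_le_sum (f := α) (fun i _ => Nat.zero_le _) (Finset.mem_univ i)
  omega

/-- The vector `v_t(x) = (x^α)` of all monomials of degree at most `t`, evaluated at `x`. -/
def monomials {n : ℕ} (t : ℕ) (x : EuclideanSpace ℝ (Fin n)) : multiIndices n t → ℝ :=
  fun α => ∏ i, x i ^ α.1 i

/-- The moment matrix `M_t(φ)`, with entries `∫ x^(α+β) dφ` for `|α|, |β| ≤ t`. -/
def momentMatrix {n : ℕ} (t : ℕ) (φ : Measure (EuclideanSpace ℝ (Fin n))) :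
    Matrix (multiIndices n t) (multiIndices n t) ℝ :=
  Matrix.of fun α β => ∫ x, ∏ i, x i ^ (α.1 i + β.1 i) ∂φ

/-- The Christoffel function `Λ^φ_t(x) = (v_t(x)ᵀ M_t(φ)⁻¹ v_t(x))⁻¹`, meaningful when
the moment matrix `M_t(φ)` is nonsingular. -/
def christoffel {n : ℕ} (t : ℕ) (φ : Measure (EuclideanSpace ℝ (Fin n)))
    (x : EuclideanSpace ℝ (Fin n)) : ℝ :=
  (monomials t x ⬝ᵥ ((momentMatrix t φ)⁻¹ *ᵥ monomials t x))⁻¹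

/-- The empirical measure `(1/N) ∑_{i<N} δ_{z i}` of the first `N` points of a sequence. -/
def empirical {n : ℕ} (z : ℕ → EuclideanSpace ℝ (Fin n)) (N : ℕ) :
    Measure (EuclideanSpace ℝ (Fin n)) :=
  (N : ℝ≥0∞)⁻¹ • ∑ i ∈ Finset.range N, Measure.dirac (z i)

/-- The set `argmax_k Λ^{φ_k}_t(x)` of all classes with maximal score at `x`; the classifier
is well defined at `x`, with value `j`, when this set is `{j}`. -/
def classifier {n m : ℕ} (t : ℕ) (φ : Fin m → Measure (EuclideanSpace ℝ (Fin n)))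
    (x : EuclideanSpace ℝ (Fin n)) : Set (Fin m) :=
  {k | ∀ l, christoffel t (φ l) x ≤ christoffel t (φ k) x}

/-- The points of `S` at distance more than `ε` from the boundary of `S`
(the distance to an empty boundary is `∞`). -/
def innerPart {n : ℕ} (S : Set (EuclideanSpace ℝ (Fin n))) (ε : ℝ) :
    Set (EuclideanSpace ℝ (Fin n)) :=
  {x ∈ S | ENNReal.ofReal ε < Metric.infEDist x (frontier S)}

/-- `φ` has a density with respect to Lebesgue measure restricted to `S`, and this density is
at least `c` almost everywhere on `S`. For open `S` and `c > 0` this implies that the support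
of `φ` is the closure of `S`, and that `φ` gives no mass to the complement of `S`. -/
def HasDensityAtLeast {n : ℕ} (φ : Measure (EuclideanSpace ℝ (Fin n)))
    (S : Set (EuclideanSpace ℝ (Fin n))) (c : ℝ) : Prop :=
  ∃ g : EuclideanSpace ℝ (Fin n) → ℝ≥0∞, Measurable g ∧
    φ = (volume.restrict S).withDensity g ∧
    ∀ᵐ x ∂(volume.restrict S), ENNReal.ofReal c ≤ g x

end Christoffel

end

noncomputable section

namespace Christoffel

/-! Write K for `christoffelKernel`, the reciprocal of the Christoffel function. When the moment
matrix is positive definite, K(x) is the maximum of p(x)² / ∫ p² dφ over nonzero polynomials p of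
degree at most t (`sq_dotProduct_le`, `exists_extremal`).

If x lies at distance at least ε from the set carrying φ, the needle (1 - |y - x|²/R²)^s is 1 at x
and uniformly small on that set, so K(x) is at least geometric in t
(`le_christoffelKernel_mul_of_dist`). If a ball about x lies inside the set, K(x) is at most a
constant times (t + 1)^n (`christoffelKernel_mul_volume_le`): translates of the extremal polynomial
bound the Lebesgue kernel of a smaller ball from below, and that kernel integrates to the dimension
of the polynomial space. Hence for large t the kernel of the correct class is smallest, with a gap
uniform in x.

For fixed t, the strong law makes the empirical moment matrices converge almost surely, so the
kernels converge uniformly on compact sets and the gap survives. -/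

/-! ### Polynomials as coefficient vectors -/

open MvPolynomial in
theorem exists_dotProduct_monomials_eq_eval {n t : ℕ} (p : MvPolynomial (Fin n) ℝ)
    (hp : p.totalDegree ≤ t) :
    ∃ a : multiIndices n t → ℝ, ∀ x : EuclideanSpace ℝ (Fin n),
      a ⬝ᵥ monomials t x = eval (fun i => x i) p := by
  refine ⟨fun α => p.coeff (Finsupp.equivFunOnFinite.symm α.1), fun x => ?_⟩
  have hsub : p.support ⊆
      (multiIndices n t).map Finsupp.equivFunOnFinite.symm.toEmbedding := by
    intro d hd
    refine Finset.mem_map.2 ⟨d, mem_multiIndices.2 ?_, by ext; simp⟩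
    have := le_totalDegree hd
    rw [Finsupp.sum_fintype _ _ (fun _ => rfl)] at this
    exact this.trans hp
  rw [eval_eq', Finset.sum_subset hsub (fun d _ hd => by simp [notMem_support_iff.1 hd]),
    Finset.sum_map]
  simp only [dotProduct, monomials]
  exact Finset.sum_coe_sort (multiIndices n t) (fun α =>
    p.coeff (Finsupp.equivFunOnFinite.symm α) * ∏ i, x i ^ α i)

/-- The polynomial with coefficient vector `a`. -/
def toPoly {n t : ℕ} (a : multiIndices n t → ℝ) : MvPolynomial (Fin n) ℝ :=
  ∑ α, MvPolynomial.monomial (Finsupp.equivFunOnFinite.symm α.1) (a α)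

open MvPolynomial in
theorem eval_toPoly {n t : ℕ} (a : multiIndices n t → ℝ) (x : EuclideanSpace ℝ (Fin n)) :
    eval (fun i => x i) (toPoly a) = a ⬝ᵥ monomials t x := by
  simp [toPoly, dotProduct, monomials, eval_monomial, Finsupp.prod_fintype]

open MvPolynomial in
theorem totalDegree_toPoly_le {n t : ℕ} (a : multiIndices n t → ℝ) :
    (toPoly a).totalDegree ≤ t := by
  refine totalDegree_finsetSum_le fun α _ => (totalDegree_monomial_le _ _).trans ?_
  rw [Finsupp.sum_fintype _ _ (fun _ => rfl)]
  exact mem_multiIndices.1 α.2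

open MvPolynomial in
theorem toPoly_injective {n t : ℕ} :
    Function.Injective (toPoly : (multiIndices n t → ℝ) → MvPolynomial (Fin n) ℝ) := by
  intro a b h
  ext α
  have hc : ∀ a : multiIndices n t → ℝ,
      (toPoly a).coeff (Finsupp.equivFunOnFinite.symm α.1) = a α := by
    intro a
    rw [toPoly, coeff_sum, Finset.sum_eq_single α]
    · exact coeff_monomial .. |>.trans (if_pos rfl)
    · intro β _ hβ
      rw [coeff_monomial, if_neg]
      exact fun h => hβ (Subtype.ext (Finsupp.equivFunOnFinite.symm.injective h))
    · exact fun h => absurd (Finset.mem_univ α) h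
  rw [← hc a, h, hc b]

open MvPolynomial in
theorem exists_totalDegree_le_eval_add {n : ℕ} (p : MvPolynomial (Fin n) ℝ) (b : Fin n → ℝ) :
    ∃ q : MvPolynomial (Fin n) ℝ, q.totalDegree ≤ p.totalDegree ∧
      ∀ x : Fin n → ℝ, eval x q = eval (fun i => x i + b i) p := by
  refine ⟨∑ d ∈ p.support, C (p.coeff d) * ∏ i, (X i + C (b i)) ^ d i, ?_, fun x => ?_⟩
  · refine totalDegree_finsetSum_le fun d hd => (totalDegree_mul _ _).trans ?_
    rw [totalDegree_C, zero_add]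
    refine ((totalDegree_finsetProd _ _).trans ?_).trans (le_totalDegree hd)
    rw [Finsupp.sum_fintype _ _ (fun _ => rfl)]
    refine Finset.sum_le_sum fun i _ => (totalDegree_pow _ _).trans ?_
    have : (X i + C (b i) : MvPolynomial (Fin n) ℝ).totalDegree ≤ 1 :=
      (totalDegree_add _ _).trans (by simp)
    nlinarith [Nat.zero_le (d i)]
  · rw [eval_eq' _ p]
    simp only [map_sum, map_prod, map_mul, map_pow, map_add, eval_C, eval_X]

/-- Translating a polynomial does not raise its degree. -/
theorem exists_dotProduct_monomials_translate {n t : ℕ} (a : multiIndices n t → ℝ)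
    (b : EuclideanSpace ℝ (Fin n)) :
    ∃ a' : multiIndices n t → ℝ, ∀ x, a' ⬝ᵥ monomials t x = a ⬝ᵥ monomials t (x + b) := by
  obtain ⟨q, hq, hqe⟩ := exists_totalDegree_le_eval_add (toPoly a) (fun i => b i)
  obtain ⟨a', ha'⟩ := exists_dotProduct_monomials_eq_eval q (hq.trans (totalDegree_toPoly_le a))
  refine ⟨a', fun x => ?_⟩
  rw [ha', hqe, ← eval_toPoly]
  rfl

open MvPolynomial in
/-- Powers of `1 - |y - x|² / R²` as polynomials of bounded degree. -/
theorem exists_needle {n t s : ℕ} (hs : 2 * s ≤ t) (x : EuclideanSpace ℝ (Fin n)) (r : ℝ) :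
    ∃ a : multiIndices n t → ℝ, ∀ y, a ⬝ᵥ monomials t y = (1 - r * dist y x ^ 2) ^ s := by
  obtain ⟨a, ha⟩ := exists_dotProduct_monomials_eq_eval (t := t)
    ((1 - C r * ∑ i, (X i - C (x i)) ^ 2) ^ s) (by
      refine (totalDegree_pow _ _).trans ?_
      have : (1 - C r * ∑ i, (X i - C (x i)) ^ 2 : MvPolynomial (Fin n) ℝ).totalDegree ≤ 2 := by
        refine (totalDegree_sub _ _).trans (max_le (by simp) ((totalDegree_mul _ _).trans ?_))
        rw [totalDegree_C, zero_add]
        refine totalDegree_finsetSum_le fun i _ => (totalDegree_pow _ _).trans ?_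
        have := (totalDegree_sub_C_le (X i : MvPolynomial (Fin n) ℝ) (x i))
        rw [totalDegree_X] at this
        omega
      nlinarith)
  refine ⟨a, fun y => ?_⟩
  rw [ha, EuclideanSpace.dist_eq, Real.sq_sqrt (by positivity)]
  simp [Real.dist_eq, sq_abs]

theorem continuous_monomials {n : ℕ} (t : ℕ) :
    Continuous (monomials t : EuclideanSpace ℝ (Fin n) → _) := by
  unfold monomials
  fun_prop

theorem continuous_dotProduct_monomials {n t : ℕ} (a : multiIndices n t → ℝ) :
    Continuous fun x : EuclideanSpace ℝ (Fin n) => a ⬝ᵥ monomials t x :=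
  continuous_const.dotProduct (continuous_monomials t)

/-- A polynomial vanishing on a nonempty open set has zero coefficients. -/
theorem eq_zero_of_eqOn_zero {n t : ℕ} {S : Set (EuclideanSpace ℝ (Fin n))} (hS : IsOpen S)
    (hne : S.Nonempty) (a : multiIndices n t → ℝ)
    (h : ∀ x ∈ S, a ⬝ᵥ monomials t x = 0) : a = 0 := by
  obtain ⟨x₀, hx₀⟩ := hne
  -- In the sup metric a ball is a product of intervals, the shape of infinite grid on which a
  -- vanishing polynomial must be zero.
  have hS' : IsOpen ((WithLp.toLp 2 : (Fin n → ℝ) → EuclideanSpace ℝ (Fin n)) ⁻¹' S) :=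
    hS.preimage (PiLp.continuous_toLp 2 _)
  obtain ⟨ε, hε, hball⟩ := Metric.isOpen_iff.1 hS' x₀.ofLp hx₀
  apply toPoly_injective
  refine MvPolynomial.funext_set (fun i => Metric.ball (x₀ i) ε)
    (fun i => ?_) fun y hy => ?_
  · rw [Real.ball_eq_Ioo]
    exact Set.Ioo_infinite (by linarith)
  · have hy' : y ∈ Metric.ball x₀.ofLp ε := by
      rw [Metric.mem_ball, dist_pi_lt_iff hε]
      exact fun i => hy i trivial
    have h1 := eval_toPoly a (WithLp.toLp 2 y)
    have h2 := eval_toPoly (0 : multiIndices n t → ℝ) (WithLp.toLp 2 y)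
    rw [h _ (hball hy')] at h1
    rw [zero_dotProduct] at h2
    exact h1.trans h2.symm

theorem card_multiIndices_le (n t : ℕ) : Fintype.card (multiIndices n t) ≤ (t + 1) ^ n := by
  rw [Fintype.card_coe]
  refine (Finset.card_filter_le _ _).trans ?_
  simp

/-! ### Moment matrices and the variational description of the kernel -/

/-- The reciprocal `v_t(x)ᵀ M_t(φ)⁻¹ v_t(x)` of the Christoffel function. -/
def christoffelKernel {n : ℕ} (t : ℕ) (φ : Measure (EuclideanSpace ℝ (Fin n)))
    (x : EuclideanSpace ℝ (Fin n)) : ℝ :=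
  monomials t x ⬝ᵥ ((momentMatrix t φ)⁻¹ *ᵥ monomials t x)

section Bounded

variable {n t : ℕ} {φ : Measure (EuclideanSpace ℝ (Fin n))}
  {S : Set (EuclideanSpace ℝ (Fin n))}

theorem momentMatrix_apply (α β : multiIndices n t) :
    momentMatrix t φ α β = ∫ x, monomials t x α * monomials t x β ∂φ := by
  simp [momentMatrix, monomials, pow_add, Finset.prod_mul_distrib]

theorem momentMatrix_isHermitian : (momentMatrix t φ).IsHermitian := by
  ext α β
  rw [conjTranspose_apply, star_trivial, momentMatrix_apply, momentMatrix_apply]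
  simp_rw [mul_comm]

theorem continuous_monomials_mul (α β : multiIndices n t) :
    Continuous fun x : EuclideanSpace ℝ (Fin n) => monomials t x α * monomials t x β :=
  ((continuous_apply α).comp (continuous_monomials t)).mul
    ((continuous_apply β).comp (continuous_monomials t))

theorem momentMatrix_mul_inv_mulVec (hpd : (momentMatrix t φ).PosDef)
    (v : multiIndices n t → ℝ) :
    momentMatrix t φ *ᵥ ((momentMatrix t φ)⁻¹ *ᵥ v) = v := by
  rw [mulVec_mulVec, mul_nonsing_inv _ ((isUnit_iff_isUnit_det _).1 hpd.isUnit), one_mulVec]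

theorem continuous_christoffelKernel :
    Continuous (christoffelKernel t φ) :=
  (continuous_monomials t).dotProduct (continuous_const.matrix_mulVec (continuous_monomials t))

variable [IsFiniteMeasure φ]

theorem integrable_of_continuous (hS : Bornology.IsBounded S) (hφ : ∀ᵐ x ∂φ, x ∈ S)
    {f : EuclideanSpace ℝ (Fin n) → ℝ} (hf : Continuous f) : Integrable f φ := by
  obtain ⟨C, hC⟩ := (hS.isCompact_closure.exists_bound_of_continuousOn hf.continuousOn)
  refine Integrable.of_bound hf.aestronglyMeasurable C ?_
  filter_upwards [hφ] with x hx using hC x (subset_closure hx)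

theorem dotProduct_momentMatrix_mulVec (hS : Bornology.IsBounded S) (hφ : ∀ᵐ x ∂φ, x ∈ S)
    (a : multiIndices n t → ℝ) :
    a ⬝ᵥ (momentMatrix t φ *ᵥ a) = ∫ x, (a ⬝ᵥ monomials t x) ^ 2 ∂φ := by
  have hint : ∀ α β : multiIndices n t,
      Integrable (fun x => a α * (monomials t x α * monomials t x β * a β)) φ := fun α β =>
    integrable_of_continuous hS hφ
      (continuous_const.mul ((continuous_monomials_mul α β).mul continuous_const))
  have hx : ∀ x : EuclideanSpace ℝ (Fin n), (a ⬝ᵥ monomials t x) ^ 2 =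
      ∑ α, ∑ β, a α * (monomials t x α * monomials t x β * a β) := by
    intro x
    rw [sq, dotProduct, Finset.sum_mul_sum]
    exact Finset.sum_congr rfl fun α _ => Finset.sum_congr rfl fun β _ => by ring
  simp_rw [hx]
  rw [integral_finsetSum _ fun α _ => integrable_finsetSum _ fun β _ => hint α β]
  refine Finset.sum_congr rfl fun α _ => ?_
  rw [integral_finsetSum _ fun β _ => hint α β, mulVec, dotProduct, Finset.mul_sum]
  refine Finset.sum_congr rfl fun β _ => ?_
  rw [integral_const_mul, integral_mul_const, momentMatrix_apply]

theorem integrable_sq_dotProduct (hS : Bornology.IsBounded S) (hφ : ∀ᵐ x ∂φ, x ∈ S)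
    (a : multiIndices n t → ℝ) : Integrable (fun x => (a ⬝ᵥ monomials t x) ^ 2) φ :=
  integrable_of_continuous hS hφ ((continuous_dotProduct_monomials a).pow 2)

/-- The quadratic form of a is ∫ p², so if it vanishes then p = 0 almost everywhere on S, hence
everywhere on the open set S by continuity, hence a = 0. -/
theorem momentMatrix_posDef (hS : Bornology.IsBounded S) (hφ : ∀ᵐ x ∂φ, x ∈ S)
    (hSo : IsOpen S) (hne : S.Nonempty) (hac : volume.restrict S ≪ φ) :
    (momentMatrix t φ).PosDef := by
  refine PosDef.of_dotProduct_mulVec_pos momentMatrix_isHermitian fun a ha => ?_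
  rw [star_trivial, dotProduct_momentMatrix_mulVec hS hφ]
  refine lt_of_le_of_ne (integral_nonneg fun x => sq_nonneg _) fun h => ha ?_
  rw [eq_comm, integral_eq_zero_iff_of_nonneg (fun x => sq_nonneg _)
    (integrable_sq_dotProduct hS hφ a)] at h
  have h' : (fun x => a ⬝ᵥ monomials t x) =ᵐ[volume.restrict S] fun _ => 0 := by
    filter_upwards [hac.ae_le h] with x hx
    exact pow_eq_zero_iff two_ne_zero |>.1 hx
  exact eq_zero_of_eqOn_zero hSo hne a (Measure.eqOn_open_of_ae_eq h' hSo
    (continuous_dotProduct_monomials a).continuousOn continuousOn_const)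

/-- Existence of a polynomial attaining equality in `sq_dotProduct_le`. -/
theorem exists_extremal (hS : Bornology.IsBounded S) (hφ : ∀ᵐ x ∂φ, x ∈ S)
    (hpd : (momentMatrix t φ).PosDef) (x : EuclideanSpace ℝ (Fin n)) :
    ∃ a : multiIndices n t → ℝ, a ⬝ᵥ monomials t x = christoffelKernel t φ x ∧
      ∫ y, (a ⬝ᵥ monomials t y) ^ 2 ∂φ = christoffelKernel t φ x := by
  refine ⟨(momentMatrix t φ)⁻¹ *ᵥ monomials t x, dotProduct_comm _ _, ?_⟩
  rw [← dotProduct_momentMatrix_mulVec hS hφ, momentMatrix_mul_inv_mulVec hpd]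
  exact dotProduct_comm _ _

/-- Cauchy–Schwarz for the inner product defined by M: evaluation at x is pairing with w = M⁻¹
v_t(x), whose squared norm is the kernel. -/
theorem sq_dotProduct_le (hS : Bornology.IsBounded S) (hφ : ∀ᵐ x ∂φ, x ∈ S)
    (hpd : (momentMatrix t φ).PosDef) (a : multiIndices n t → ℝ)
    (x : EuclideanSpace ℝ (Fin n)) :
    (a ⬝ᵥ monomials t x) ^ 2 ≤
      christoffelKernel t φ x * ∫ y, (a ⬝ᵥ monomials t y) ^ 2 ∂φ := by
  rw [← dotProduct_momentMatrix_mulVec hS hφ]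
  set M := momentMatrix t φ with hM
  set w := M⁻¹ *ᵥ monomials t x with hw
  have hMw : M *ᵥ w = monomials t x := momentMatrix_mul_inv_mulVec hpd _
  have hwa : w ⬝ᵥ (M *ᵥ a) = a ⬝ᵥ monomials t x := by
    have hT : Mᵀ = M := by
      have := hpd.isHermitian.eq
      rwa [conjTranspose_eq_transpose_of_trivial] at this
    rw [dotProduct_mulVec, ← mulVec_transpose, hT, hMw, dotProduct_comm]
  have hK : w ⬝ᵥ (M *ᵥ w) = christoffelKernel t φ x := by
    rw [hMw, dotProduct_comm]; rfl
  -- The squared norm of s • a + w is a nonnegative quadratic in s, so its discriminant is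
  -- nonpositive.
  have hquad : ∀ s : ℝ, 0 ≤ (a ⬝ᵥ (M *ᵥ a)) * (s * s) + (2 * (a ⬝ᵥ monomials t x)) * s +
      christoffelKernel t φ x := by
    intro s
    have h0 := hpd.posSemidef.dotProduct_mulVec_nonneg (s • a + w)
    rw [star_trivial, mulVec_add, mulVec_smul, add_dotProduct, dotProduct_add, dotProduct_add,
      smul_dotProduct, smul_dotProduct, dotProduct_smul, dotProduct_smul, hwa, hK, hMw] at h0
    simp only [smul_eq_mul] at h0
    linarith
  have := discrim_le_zero hquad
  rw [discrim] at this
  nlinarith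

/-- Test with the constant polynomial 1, the needle with s = 0. -/
theorem one_le_christoffelKernel [IsProbabilityMeasure φ] (hS : Bornology.IsBounded S)
    (hφ : ∀ᵐ x ∂φ, x ∈ S) (hpd : (momentMatrix t φ).PosDef) (x : EuclideanSpace ℝ (Fin n)) :
    1 ≤ christoffelKernel t φ x := by
  obtain ⟨a, ha⟩ := exists_needle (n := n) (t := t) (s := 0) (Nat.zero_le _) 0 0
  have := sq_dotProduct_le hS hφ hpd a x
  simpa [ha] using this

/-- Integrating entrywise turns the kernel into the trace of M⁻¹ M, the dimension of the polynomial
space. -/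
theorem integral_christoffelKernel (hS : Bornology.IsBounded S) (hφ : ∀ᵐ x ∂φ, x ∈ S)
    (hpd : (momentMatrix t φ).PosDef) :
    ∫ x, christoffelKernel t φ x ∂φ = Fintype.card (multiIndices n t) := by
  set M := momentMatrix t φ with hM
  have hint : ∀ α β : multiIndices n t,
      Integrable (fun x => M⁻¹ α β * (monomials t x β * monomials t x α)) φ := fun α β =>
    integrable_of_continuous hS hφ (continuous_const.mul (continuous_monomials_mul β α))
  have hx : ∀ x : EuclideanSpace ℝ (Fin n), christoffelKernel t φ x =
      ∑ α, ∑ β, M⁻¹ α β * (monomials t x β * monomials t x α) := by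
    intro x
    rw [christoffelKernel, dotProduct]
    refine Finset.sum_congr rfl fun α _ => ?_
    rw [mulVec, dotProduct, Finset.mul_sum]
    exact Finset.sum_congr rfl fun β _ => by ring
  simp_rw [hx]
  rw [integral_finsetSum _ fun α _ => integrable_finsetSum _ fun β _ => hint α β]
  rw [← trace_one (R := ℝ), ← nonsing_inv_mul M ((isUnit_iff_isUnit_det _).1 hpd.isUnit), trace]
  refine Finset.sum_congr rfl fun α _ => ?_
  rw [integral_finsetSum _ fun β _ => hint α β, diag_apply, mul_apply]
  refine Finset.sum_congr rfl fun β _ => ?_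
  rw [integral_const_mul, hM, momentMatrix_apply]

/-! ### Growth of the kernel outside and inside the support -/

/-- Away from the support the kernel grows geometrically in the degree. -/
theorem le_christoffelKernel_mul_of_dist [IsProbabilityMeasure φ] (hS : Bornology.IsBounded S)
    (hφ : ∀ᵐ x ∂φ, x ∈ S) (hpd : (momentMatrix t φ).PosDef) {x : EuclideanSpace ℝ (Fin n)}
    {ε R : ℝ} (hR : 0 < R) (hε : 0 < ε) (hlow : ∀ y ∈ S, ε ≤ dist y x)
    (hup : ∀ y ∈ S, dist y x ≤ R) {s : ℕ} (hs : 2 * s ≤ t) :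
    1 ≤ christoffelKernel t φ x * ((1 - ε ^ 2 / R ^ 2) ^ s) ^ 2 := by
  obtain ⟨a, ha⟩ := exists_needle hs x (R ^ 2)⁻¹
  have h := sq_dotProduct_le hS hφ hpd a x
  rw [ha, dist_self] at h
  have hle : ∫ y, (a ⬝ᵥ monomials t y) ^ 2 ∂φ ≤ ((1 - ε ^ 2 / R ^ 2) ^ s) ^ 2 := by
    have : ∫ y, (a ⬝ᵥ monomials t y) ^ 2 ∂φ ≤ ∫ _, ((1 - ε ^ 2 / R ^ 2) ^ s) ^ 2 ∂φ := by
      refine integral_mono_ae (integrable_sq_dotProduct hS hφ a) (integrable_const _) ?_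
      filter_upwards [hφ] with y hy
      have h1 : (R ^ 2)⁻¹ * dist y x ^ 2 ≤ 1 := by
        rw [inv_mul_le_one₀ (by positivity)]
        exact pow_le_pow_left₀ dist_nonneg (hup y hy) 2
      have h2 : ε ^ 2 / R ^ 2 ≤ (R ^ 2)⁻¹ * dist y x ^ 2 := by
        rw [div_eq_inv_mul]
        have := hlow y hy
        gcongr
      rw [ha]
      refine pow_le_pow_left₀ (pow_nonneg (by linarith) _) (pow_le_pow_left₀ (by linarith) ?_ _) 2
      linarith
    simpa using this
  have hK := one_le_christoffelKernel hS hφ hpd x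
  calc (1 : ℝ) = ((1 - (R ^ 2)⁻¹ * 0 ^ 2) ^ s) ^ 2 := by simp
    _ ≤ _ := h
    _ ≤ _ := mul_le_mul_of_nonneg_left hle (by linarith)

/-- In the interior of the support the kernel grows at most polynomially in the degree. -/
theorem christoffelKernel_mul_volume_le (hS : Bornology.IsBounded S) (hφ : ∀ᵐ x ∂φ, x ∈ S)
    (hpd : (momentMatrix t φ).PosDef) {c : ℝ} (hc : 0 < c)
    (hle : ENNReal.ofReal c • volume.restrict S ≤ φ) {x : EuclideanSpace ℝ (Fin n)} {r : ℝ}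
    (hr : 0 < r) (hball : Metric.ball x (2 * r) ⊆ S) :
    c * christoffelKernel t φ x * volume.real (Metric.ball (0 : EuclideanSpace ℝ (Fin n)) r) ≤
      (t + 1) ^ n := by
  set A := Metric.ball x r
  set μ : Measure (EuclideanSpace ℝ (Fin n)) := volume.restrict A with hμ
  have : IsFiniteMeasure μ := ⟨by
    rw [hμ, Measure.restrict_apply_univ]; exact measure_ball_lt_top⟩
  have hA : Bornology.IsBounded A := Metric.isBounded_ball
  have hμA : ∀ᵐ y ∂μ, y ∈ A := ae_restrict_mem measurableSet_ball
  have hμpd : (momentMatrix t μ).PosDef :=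
    momentMatrix_posDef hA hμA Metric.isOpen_ball ⟨x, Metric.mem_ball_self hr⟩
      Measure.AbsolutelyContinuous.rfl
  have hlow : ∀ y ∈ A, c * christoffelKernel t φ x ≤ christoffelKernel t μ y := by
    intro y hy
    obtain ⟨a, hax, haint⟩ := exists_extremal hS hφ hpd x
    -- The translate takes at y the value that the extremal polynomial takes at x.
    obtain ⟨b, hb⟩ := exists_dotProduct_monomials_translate a (x - y)
    have h1 := sq_dotProduct_le hA hμA hμpd b y
    rw [hb, add_sub_cancel, hax] at h1
    have h2 : c * ∫ z, (b ⬝ᵥ monomials t z) ^ 2 ∂μ ≤ christoffelKernel t φ x := by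
      set f : EuclideanSpace ℝ (Fin n) → EuclideanSpace ℝ (Fin n) := fun z => z + (x - y)
      set B := Metric.ball x (2 * r)
      have hcont := (continuous_dotProduct_monomials a).pow 2
      have hf : Continuous f := continuous_id.add continuous_const
      -- Both z and y lie in the ball of radius r, so the shifted point is within 2 * r of x; this
      -- is why the hypothesis has the doubled radius.
      have hsub : A ⊆ f ⁻¹' B := by
        intro z hz
        have h5 : dist (z + (x - y)) x = dist z y := by
          rw [dist_eq_norm, dist_eq_norm]; congr 1; abel
        have h6 := dist_triangle z x y
        rw [Metric.mem_ball] at hz hy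
        rw [dist_comm] at hy
        rw [Set.mem_preimage, Metric.mem_ball, h5]
        linarith
      have hpre : ∫ z in f ⁻¹' B, (a ⬝ᵥ monomials t (f z)) ^ 2 =
          ∫ z in B, (a ⬝ᵥ monomials t z) ^ 2 :=
        (measurePreserving_add_right volume (x - y)).setIntegral_preimage_emb
          (measurableEmbedding_addRight (x - y)) (fun z => (a ⬝ᵥ monomials t z) ^ 2) B
      have hfB : Bornology.IsBounded (f ⁻¹' B) := by
        have : f ⁻¹' B ⊆ Metric.ball y (2 * r) := by
          intro z hz
          have h5 : dist (z + (x - y)) x = dist z y := by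
            rw [dist_eq_norm, dist_eq_norm]; congr 1; abel
          rwa [Set.mem_preimage, Metric.mem_ball, h5] at hz
        exact Metric.isBounded_ball.subset this
      have hmf : MeasurableSet (f ⁻¹' B) := hf.measurable measurableSet_ball
      calc c * ∫ z, (b ⬝ᵥ monomials t z) ^ 2 ∂μ
          = c * ∫ z in A, (a ⬝ᵥ monomials t (f z)) ^ 2 := by simp_rw [hb, hμ, f]
        _ ≤ c * ∫ z in f ⁻¹' B, (a ⬝ᵥ monomials t (f z)) ^ 2 := by
          refine mul_le_mul_of_nonneg_left (setIntegral_mono_set ?_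
            (ae_of_all _ fun z => sq_nonneg _) hsub.eventuallyLE) hc.le
          have : IsFiniteMeasure (volume.restrict (f ⁻¹' B)) :=
            ⟨by rw [Measure.restrict_apply_univ]; exact hfB.measure_lt_top⟩
          exact integrable_of_continuous hfB (ae_restrict_mem hmf) (hcont.comp hf)
        _ = ∫ z, (a ⬝ᵥ monomials t z) ^ 2 ∂(ENNReal.ofReal c • volume.restrict B) := by
          rw [hpre, integral_smul_measure, ENNReal.toReal_ofReal hc.le, smul_eq_mul]
        _ ≤ ∫ z, (a ⬝ᵥ monomials t z) ^ 2 ∂φ := by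
          refine integral_mono_measure ?_ (ae_of_all _ fun z => sq_nonneg _)
            (integrable_sq_dotProduct hS hφ a)
          exact le_trans (by gcongr) hle
        _ = _ := haint
    have h3 := hpd.inv.posSemidef.dotProduct_mulVec_nonneg (monomials t x)
    have h4 := hμpd.inv.posSemidef.dotProduct_mulVec_nonneg (monomials t y)
    rw [star_trivial] at h3 h4
    change 0 ≤ christoffelKernel t φ x at h3
    change 0 ≤ christoffelKernel t μ y at h4
    -- Combining `h1` and `h2` gives c K(x)² ≤ K_μ(y) K(x); cancel K(x) when it is positive.
    rcases h3.eq_or_lt with h3 | h3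
    · rw [← h3, mul_zero]; exact h4
    · refine le_of_mul_le_mul_right ?_ h3
      nlinarith
  have hvol : volume.real (Metric.ball (0 : EuclideanSpace ℝ (Fin n)) r) = μ.real Set.univ := by
    rw [hμ, measureReal_restrict_apply_univ, measureReal_def, measureReal_def,
      Measure.addHaar_ball_center volume x r]
  calc _ = ∫ _, c * christoffelKernel t φ x ∂μ := by
        rw [integral_const, hvol, smul_eq_mul, mul_comm]
    _ ≤ ∫ y, christoffelKernel t μ y ∂μ := by
        refine integral_mono_ae (integrable_const _)
          (integrable_of_continuous hA hμA continuous_christoffelKernel) ?_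
        filter_upwards [hμA] with y hy using hlow y hy
    _ = Fintype.card (multiIndices n t) := integral_christoffelKernel hA hμA hμpd
    _ ≤ (t + 1) ^ n := by exact_mod_cast card_multiIndices_le n t

end Bounded

/-! ### Consequences of the density bound -/

theorem HasDensityAtLeast.ae_mem {n : ℕ} {φ : Measure (EuclideanSpace ℝ (Fin n))}
    {S : Set (EuclideanSpace ℝ (Fin n))} {c : ℝ} (h : HasDensityAtLeast φ S c)
    (hS : MeasurableSet S) : ∀ᵐ x ∂φ, x ∈ S := by
  obtain ⟨g, -, rfl, -⟩ := h
  exact (withDensity_absolutelyContinuous _ g).ae_le (ae_restrict_mem hS)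

theorem HasDensityAtLeast.smul_restrict_le {n : ℕ} {φ : Measure (EuclideanSpace ℝ (Fin n))}
    {S : Set (EuclideanSpace ℝ (Fin n))} {c : ℝ} (h : HasDensityAtLeast φ S c) :
    ENNReal.ofReal c • volume.restrict S ≤ φ := by
  obtain ⟨g, -, rfl, hg⟩ := h
  rw [← withDensity_const]
  exact withDensity_mono hg

theorem HasDensityAtLeast.absolutelyContinuous {n : ℕ}
    {φ : Measure (EuclideanSpace ℝ (Fin n))} {S : Set (EuclideanSpace ℝ (Fin n))} {c : ℝ}
    (hc : 0 < c) (h : HasDensityAtLeast φ S c) : volume.restrict S ≪ φ :=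
  (Measure.absolutelyContinuous_smul (ENNReal.ofReal_pos.2 hc).ne').trans
    h.smul_restrict_le.absolutelyContinuous

theorem HasDensityAtLeast.nonempty {n : ℕ} {φ : Measure (EuclideanSpace ℝ (Fin n))}
    [IsProbabilityMeasure φ] {S : Set (EuclideanSpace ℝ (Fin n))} {c : ℝ}
    (h : HasDensityAtLeast φ S c) (hS : MeasurableSet S) : S.Nonempty :=
  (h.ae_mem hS).exists

/-! ### Convergence of empirical moments and kernels -/

theorem momentMatrix_empirical {n t : ℕ} (z : ℕ → EuclideanSpace ℝ (Fin n)) (N : ℕ)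
    (α β : multiIndices n t) :
    momentMatrix t (empirical z N) α β =
      (∑ i ∈ Finset.range N, monomials t (z i) α * monomials t (z i) β) / N := by
  rw [momentMatrix_apply, empirical, integral_smul_measure,
    integral_finsetSum_measure fun i _ => integrable_dirac (by simp [ENNReal.mul_lt_top])]
  simp [div_eq_inv_mul]

/-- Strong law of large numbers for empirical moment matrices. -/
theorem tendsto_momentMatrix_empirical {n t : ℕ} {φ : Measure (EuclideanSpace ℝ (Fin n))}
    [IsFiniteMeasure φ] {S : Set (EuclideanSpace ℝ (Fin n))} (hS : Bornology.IsBounded S)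
    (hφ : ∀ᵐ x ∂φ, x ∈ S) {Ω : Type*} [MeasurableSpace Ω] {P : Measure Ω}
    {ξ : ℕ → Ω → EuclideanSpace ℝ (Fin n)} (hlaw : ∀ i, HasLaw (ξ i) φ P)
    (hind : iIndepFun ξ P) :
    ∀ᵐ ω ∂P, Tendsto (fun N => momentMatrix t (empirical (fun i => ξ i ω) N)) atTop
      (nhds (momentMatrix t φ)) := by
  have key : ∀ α β : multiIndices n t, ∀ᵐ ω ∂P, Tendsto
      (fun N => momentMatrix t (empirical (fun i => ξ i ω) N) α β) atTop
      (nhds (momentMatrix t φ α β)) := by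
    intro α β
    set f : EuclideanSpace ℝ (Fin n) → ℝ := fun x => monomials t x α * monomials t x β
    have hf : Continuous f := continuous_monomials_mul α β
    have hfi : Integrable f φ := integrable_of_continuous hS hφ hf
    have hl := hlaw 0
    have h := strong_law_ae_real (μ := P) (fun i => f ∘ ξ i)
      (Integrable.comp_aemeasurable (by rwa [hl.map_eq]) hl.aemeasurable)
      (fun i j hij => (hind.indepFun hij).comp hf.measurable hf.measurable)
      (fun i => IdentDistrib.comp ⟨(hlaw i).aemeasurable, hl.aemeasurable,
        by rw [(hlaw i).map_eq, hl.map_eq]⟩ hf.measurable)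
    filter_upwards [h] with ω hω
    rw [hl.integral_comp hf.aestronglyMeasurable] at hω
    simp_rw [momentMatrix_empirical, momentMatrix_apply]
    exact hω
  have key' := ae_all_iff.2 fun α => ae_all_iff.2 fun β => key α β
  filter_upwards [key'] with ω hω
  exact tendsto_pi_nhds.2 fun α => tendsto_pi_nhds.2 fun β => hω α β

/-- Kernels of converging moment matrices converge uniformly on compact sets. -/
theorem eventually_det_ne_zero_and_abs_sub_lt {n t : ℕ}
    {φ : Measure (EuclideanSpace ℝ (Fin n))} {φN : ℕ → Measure (EuclideanSpace ℝ (Fin n))}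
    (hdet : (momentMatrix t φ).det ≠ 0)
    (hlim : Tendsto (fun N => momentMatrix t (φN N)) atTop (nhds (momentMatrix t φ)))
    {K : Set (EuclideanSpace ℝ (Fin n))} (hK : IsCompact K) {δ : ℝ} (hδ : 0 < δ) :
    ∀ᶠ N in atTop, (momentMatrix t (φN N)).det ≠ 0 ∧
      ∀ x ∈ K, |christoffelKernel t (φN N) x - christoffelKernel t φ x| < δ := by
  have hinv : Tendsto (fun N => (momentMatrix t (φN N))⁻¹) atTop
      (nhds (momentMatrix t φ)⁻¹) := by
    refine (continuousAt_matrix_inv _ ?_).tendsto.comp hlim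
    rw [Ring.inverse_eq_inv']
    exact continuousAt_inv₀ hdet
  have hunif : ∀ᶠ M in nhds (momentMatrix t φ)⁻¹, ∀ x ∈ K,
      |monomials t x ⬝ᵥ (M *ᵥ monomials t x) - christoffelKernel t φ x| < δ := by
    -- Joint continuity in the matrix and the point, with compactness of K, gives the uniformity in
    -- x.
    refine hK.eventually_forall_of_forall_eventually fun x _ => ?_
    have hc : Continuous fun z : Matrix (multiIndices n t) (multiIndices n t) ℝ ×
        EuclideanSpace ℝ (Fin n) =>
        |monomials t z.2 ⬝ᵥ (z.1 *ᵥ monomials t z.2) - christoffelKernel t φ z.2| :=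
      ((((continuous_monomials t).comp continuous_snd).dotProduct
        (continuous_fst.matrix_mulVec ((continuous_monomials t).comp continuous_snd))).sub
        (continuous_christoffelKernel.comp continuous_snd)).abs
    have h0 := hc.continuousAt.eventually_lt (x₀ := ((momentMatrix t φ)⁻¹, x))
      (continuousAt_const (y := δ)) (by simpa [christoffelKernel] using hδ)
    exact h0
  filter_upwards [hinv.eventually hunif, (Continuous.matrix_det continuous_id).continuousAt
    |>.tendsto.comp hlim |>.eventually_ne hdet] with N h1 h2
  exact ⟨h2, h1⟩

/-! ### Inner parts, degree threshold and classifier -/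

/-- A ball is connected, so it cannot leave S without meeting the frontier. -/
theorem ball_subset_of_mem_innerPart {n : ℕ} {S : Set (EuclideanSpace ℝ (Fin n))}
    (hS : IsOpen S) {ε : ℝ} (hε : 0 < ε) {x : EuclideanSpace ℝ (Fin n)}
    (hx : x ∈ innerPart S ε) : Metric.ball x ε ⊆ S := by
  refine (convex_ball x ε).isPreconnected.subset_of_closure_inter_subset hS
    ⟨x, Metric.mem_ball_self hε, hx.1⟩ fun y hy => ?_
  by_contra hyS
  have hyf : y ∈ frontier S := by
    rw [hS.frontier_eq]; exact ⟨hy.1, hyS⟩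
  have h1 := hx.2.trans_le (Metric.infEDist_le_edist_of_mem hyf)
  rw [edist_dist, ENNReal.ofReal_lt_ofReal_iff_of_nonneg hε.le, dist_comm] at h1
  exact absurd (Metric.mem_ball.1 hy.2) h1.not_gt

/-- Geometric decay beats polynomial growth. -/
theorem exists_forall_lt_pow_mul_lt (n : ℕ) {ρ κ : ℝ} (hρ0 : 0 < ρ) (hρ1 : ρ < 1)
    (hκ : 0 < κ) :
    ∃ t₀ : ℕ, ∀ t : ℕ, t₀ < t → ((t : ℝ) + 1) ^ n * (ρ ^ (t / 2)) ^ 2 < κ := by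
  have h := tendsto_pow_const_mul_const_pow_of_abs_lt_one n (r := ρ)
    (by rwa [abs_of_pos hρ0])
  -- The limit is used at 2 * (t / 2) + 2, which is at least t + 1 for either parity; the factor ρ ^
  -- 2 pays for the two extra powers.
  obtain ⟨t₀, h₀⟩ := eventually_atTop.1 (h.eventually_lt_const (u := κ * ρ ^ 2) (by positivity))
  refine ⟨t₀, fun t ht => ?_⟩
  have h1 := h₀ (2 * (t / 2) + 2) (by omega)
  have h2 : ((t : ℝ) + 1) ^ n ≤ ((2 * (t / 2) + 2 : ℕ) : ℝ) ^ n := by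
    refine pow_le_pow_left₀ (by positivity) ?_ n
    exact_mod_cast (by omega : t + 1 ≤ 2 * (t / 2) + 2)
  rw [pow_add, ← mul_assoc] at h1
  have h3 := lt_of_mul_lt_mul_right h1 (by positivity)
  rw [← pow_mul, mul_comm (t / 2) 2]
  exact (mul_le_mul_of_nonneg_right h2 (by positivity)).trans_lt h3

/-- Inversion reverses strict order between positive numbers; positivity at j suffices because the
other kernels are larger. -/
theorem classifier_eq_singleton {n m t : ℕ} {φ : Fin m → Measure (EuclideanSpace ℝ (Fin n))}
    {x : EuclideanSpace ℝ (Fin n)} {j : Fin m} (hj : 0 < christoffelKernel t (φ j) x)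
    (h : ∀ k, k ≠ j → christoffelKernel t (φ j) x < christoffelKernel t (φ k) x) :
    classifier t φ x = {j} := by
  have hlt : ∀ k, k ≠ j → christoffel t (φ k) x < christoffel t (φ j) x := fun k hk =>
    inv_strictAnti₀ hj (h k hk)
  ext k
  rw [Set.mem_singleton_iff]
  constructor
  · intro hk
    by_contra hkj
    exact absurd (hk j) (hlt k hkj).not_ge
  · rintro rfl l
    rcases eq_or_ne l k with rfl | hl
    · exact le_rfl
    · exact (hlt l hl).le

end Christoffel

end

/-! ### The main theorem -/

open Christoffel in
theorem theorem2p4 {n m : ℕ}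
    (X : Fin m → Set (EuclideanSpace ℝ (Fin n)))
    (hX_open : ∀ j, IsOpen (X j))
    (hX_cpt : ∀ j, IsCompact (closure (X j)))
    (hX_disj : ∀ i j, i ≠ j → Disjoint (X i) (X j))
    (φ : Fin m → Measure (EuclideanSpace ℝ (Fin n)))
    [∀ j, IsProbabilityMeasure (φ j)]
    (c : ℝ) (hc : 0 < c)
    (hφ : ∀ j, Christoffel.HasDensityAtLeast (φ j) (X j) c)
    (ε : ℝ) (hε : 0 < ε) :
    ∃ tε : ℕ, ∀ (Ω : Type*) [MeasurableSpace Ω] (P : Measure Ω) [IsProbabilityMeasure P]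
      (ξ : Fin m → ℕ → Ω → EuclideanSpace ℝ (Fin n)),
      (∀ j i, HasLaw (ξ j i) (φ j) P) →
      (∀ j, iIndepFun (ξ j) P) →
      ∀ t : ℕ, tε < t → ∀ᵐ ω ∂P, ∀ᶠ N : ℕ in atTop,
        (∀ k, (Christoffel.momentMatrix t
          (Christoffel.empirical (fun i => ξ k i ω) N)).det ≠ 0) ∧
        ∀ j, ∀ x ∈ Christoffel.innerPart (X j) ε,
          Christoffel.classifier t
            (fun k => Christoffel.empirical (fun i => ξ k i ω) N) x = {j} := by
  have hK : IsCompact (⋃ j, closure (X j)) := isCompact_iUnion hX_cpt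
  have hXK : ∀ j, X j ⊆ ⋃ j, closure (X j) := fun j =>
    subset_closure.trans (Set.subset_iUnion (fun j => closure (X j)) j)
  have hbdd : ∀ j, Bornology.IsBounded (X j) := fun j => hK.isBounded.subset (hXK j)
  have hmem : ∀ j, ∀ᵐ x ∂φ j, x ∈ X j := fun j => (hφ j).ae_mem (hX_open j).measurableSet
  have hpd : ∀ t j, (momentMatrix t (φ j)).PosDef := fun t j =>
    momentMatrix_posDef (hbdd j) (hmem j) (hX_open j)
      ((hφ j).nonempty (hX_open j).measurableSet) ((hφ j).absolutelyContinuous hc)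
  obtain ⟨C, hC⟩ := Metric.isBounded_iff.1 hK.isBounded
  -- The maximum with 2 * ε forces ε < R, so that ρ below is positive.
  set R := max C (2 * ε) with hR
  have hεR : ε < R := (by linarith : ε < 2 * ε).trans_le (le_max_right _ _)
  have hRpos : 0 < R := hε.trans hεR
  set ρ := 1 - ε ^ 2 / R ^ 2 with hρ
  have hρ0 : 0 < ρ := by
    rw [hρ, sub_pos, div_lt_one (by positivity)]
    exact pow_lt_pow_left₀ hεR hε.le two_ne_zero
  have hρ1 : ρ < 1 := by
    have : 0 < ε ^ 2 / R ^ 2 := by positivity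
    linarith
  set V := volume.real (Metric.ball (0 : EuclideanSpace ℝ (Fin n)) (ε / 2)) with hV
  have hVpos : 0 < V :=
    ENNReal.toReal_pos (Metric.measure_ball_pos _ _ (by positivity)).ne' measure_ball_lt_top.ne
  obtain ⟨t₀, ht₀⟩ := exists_forall_lt_pow_mul_lt n hρ0 hρ1 (mul_pos hc hVpos)
  refine ⟨t₀, fun Ω _ P _ ξ hlaw hind t ht => ?_⟩
  -- κ₁ bounds the kernel of the correct class from above, κ₂ bounds all the others from below.
  set κ₁ := ((t : ℝ) + 1) ^ n / (c * V) with hκ₁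
  set κ₂ := ((ρ ^ (t / 2)) ^ 2)⁻¹ with hκ₂
  have hκ : κ₁ < κ₂ := by
    rw [hκ₁, hκ₂, div_lt_iff₀ (by positivity), inv_mul_eq_div, lt_div_iff₀ (by positivity)]
    exact ht₀ t ht
  have hinner : ∀ j, ∀ x ∈ innerPart (X j) ε, christoffelKernel t (φ j) x ≤ κ₁ := by
    intro j x hx
    have h := christoffelKernel_mul_volume_le (hbdd j) (hmem j) (hpd t j) hc
      (hφ j).smul_restrict_le (x := x) (half_pos hε)
      (by rw [mul_div_cancel₀ _ two_ne_zero]; exact ball_subset_of_mem_innerPart (hX_open j) hε hx)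
    rw [hκ₁, le_div_iff₀ (by positivity)]
    linarith
  have houter : ∀ j k, k ≠ j → ∀ x ∈ innerPart (X j) ε, κ₂ ≤ christoffelKernel t (φ k) x := by
    intro j k hkj x hx
    have hball := ball_subset_of_mem_innerPart (hX_open j) hε hx
    have h := le_christoffelKernel_mul_of_dist (hbdd k) (hmem k) (hpd t k) (x := x) hRpos hε
      (fun y hy => not_lt.1 fun hlt => Set.disjoint_left.1 (hX_disj k j hkj) hy (hball hlt))
      (fun y hy => (hC (hXK k hy) (hXK j hx.1)).trans (le_max_left _ _)) (s := t / 2) (by omega)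
    rw [hκ₂, inv_le_iff_one_le_mul₀ (by positivity)]
    exact h
  -- Since the true kernels are at least 1, an error below 1 / 2 keeps the empirical ones positive;
  -- half the gap keeps their order.
  set δ := min (1 / 2) ((κ₂ - κ₁) / 2) with hδ
  have hδpos : 0 < δ := lt_min (by norm_num) (by linarith)
  have hδ1 : δ ≤ 1 / 2 := min_le_left _ _
  have hδ2 : δ ≤ (κ₂ - κ₁) / 2 := min_le_right _ _
  have hlim := ae_all_iff.2 fun k =>
    tendsto_momentMatrix_empirical (t := t) (hbdd k) (hmem k) (hlaw k) (hind k)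
  filter_upwards [hlim] with ω hω
  have hev := eventually_all.2 fun k => eventually_det_ne_zero_and_abs_sub_lt
    (hpd t k).det_pos.ne' (hω k) hK hδpos
  filter_upwards [hev] with N hN
  refine ⟨fun k => (hN k).1, fun j x hx => ?_⟩
  have hxK := hXK j hx.1
  have hj := abs_lt.1 ((hN j).2 x hxK)
  refine classifier_eq_singleton ?_ fun k hkj => ?_
  · linarith [one_le_christoffelKernel (hbdd j) (hmem j) (hpd t j) x]
  · have hk := abs_lt.1 ((hN k).2 x hxK)
    linarith [hinner j x hx, houter j k hkj x hx]
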